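/- Let $d\ge 0$ be an integer and $n=d+1$. Let $V=(\mathbb{C}^d)^n$, whose points are families $(p_1,\dots,p_n)$ of vectors of $\mathbb{C}^d$, let $p\cdot q=\sum_{a=1}^d p^a q^a$ be the bilinear dot product, and let $O(d)=O(d,\mathbb{C})=\{A\in\mathbb{C}^{d\times d} : AA^{T}=1\}$ act on $V$ by $p_i\mapsto Ap_i$ for all $i$, and $S_n$ by permuting the $p_i$. Let $R=\mathbb{C}[V]^{O(d)\times S_n}$ be the algebra of invariant polynomials. Then the $d(d+3)/2$ polynomials $$\theta_k=\sum_{i=1}^{d+1}(p_i\cdot p_i)^k\quad(1\le k\le d),\qquad \alpha_k=\sum_{1\le i<j\le d+1}(p_i\cdot p_j)^k\quad\bigl(1\le k\le d(d+1)/2\bigr)$$ form a homogeneous system of parameters (HSOP) of $R$: they are homogeneous elements of $R$ of positive degree, they are algebraically independent over $\mathbb{C}$, and $R$ is a finitely generated module over the subalgebra $\mathbb{C}[\theta_1,\dots,\theta_d,\alpha_1,\dots,\alpha_{d(d+1)/2}]$. Moreover they satisfy the nullcone condition: their common zero locus in $V$ equals the nullcone $\{v\in V : f(v)=0 \text{ for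 every homogeneous } f\in R \text{ of positive degree}\}$. -/

import Mathlib

namespace LorentzPerm

/-- A point of `V ≅ ℂ^(nd)` is a family of `n` momenta `p_i ∈ ℂ^d`; `X (i, a)` is the `a`-th
component of `p_i`, and this ring is `ℂ[V]`. -/
abbrev PolyRing (n d : ℕ) := MvPolynomial (Fin n × Fin d) ℂ

/-- The pull-back `f ↦ f ∘ g` along the linear map `g` of `V` given by `A` and `σ`, namely
`(g p)_i = A p_{σ⁻¹ i}`. -/
noncomputable def pullback {n d : ℕ} (A : Matrix (Fin d) (Fin d) ℂ) (σ : Equiv.Perm (Fin n)) :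
    PolyRing n d →ₐ[ℂ] PolyRing n d :=
  MvPolynomial.aeval fun x : Fin n × Fin d =>
    ∑ b : Fin d, MvPolynomial.C (A x.2 b) * MvPolynomial.X (σ⁻¹ x.1, b)

/-- The invariant algebra `ℂ[V]^(O(d) × P)`, for `O(d) = O(d, ℂ)` (the complex matrices with
`A * Aᵀ = 1`) and a group `P` of permutations of the `n` momenta. -/
noncomputable def invariantAlgebra (n d : ℕ) (P : Subgroup (Equiv.Perm (Fin n))) :
    Subalgebra ℂ (PolyRing n d) where
  carrier := {f | ∀ A ∈ Matrix.orthogonalGroup (Fin d) ℂ, ∀ σ ∈ P, pullback A σ f = f}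
  mul_mem' := fun hf hg A hA σ hσ => by rw [map_mul, hf A hA σ hσ, hg A hA σ hσ]
  add_mem' := fun hf hg A hA σ hσ => by rw [map_add, hf A hA σ hσ, hg A hA σ hσ]
  algebraMap_mem' := fun c A _ σ _ => (pullback A σ).commutes c

/-- The family `f` is a homogeneous system of parameters of the algebra `R` of polynomials:
its members are homogeneous elements of `R` of positive degree, they are algebraically independent,
and `R` is a finitely generated module over the subalgebra `K[f]`. -/
structure IsHSOP {K ι τ : Type*} [Field K] (R : Subalgebra K (MvPolynomial τ K))
    (f : ι → MvPolynomial τ K) : Prop where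
  mem : ∀ i, f i ∈ R
  homogeneous : ∀ i, ∃ k : ℕ, 0 < k ∧ (f i).IsHomogeneous k
  algebraicIndependent : AlgebraicIndependent K f
  finite : ∃ t : Finset (MvPolynomial τ K), ∀ g : MvPolynomial τ K,
    g ∈ R ↔ g ∈ Submodule.span (Algebra.adjoin K (Set.range f)) (t : Set (MvPolynomial τ K))

/-- The nullcone of `R`: the common zeros of all homogeneous elements of `R` of positive degree. -/
def nullcone {K τ : Type*} [Field K] (R : Subalgebra K (MvPolynomial τ K)) : Set (τ → K) :=
  {v | ∀ f ∈ R, ∀ k : ℕ, 0 < k → f.IsHomogeneous k → MvPolynomial.eval v f = 0}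

/-- The nullcone condition: the common zero locus of the family `f` is the nullcone of `R`. -/
def NullconeCondition {K ι τ : Type*} [Field K] (R : Subalgebra K (MvPolynomial τ K))
    (f : ι → MvPolynomial τ K) : Prop :=
  {v : τ → K | ∀ i, MvPolynomial.eval v (f i) = 0} = nullcone R

/-- The (complex bilinear) dot product `p_i · p_j`, as an element of `ℂ[V]`. -/
noncomputable def dot {n d : ℕ} (i j : Fin n) : PolyRing n d :=
  ∑ a : Fin d, MvPolynomial.X (i, a) * MvPolynomial.X (j, a)

/-- `θ_k = ∑_i (p_i · p_i)^k`. -/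
noncomputable def theta (n d k : ℕ) : PolyRing n d :=
  ∑ i : Fin n, dot i i ^ k

/-- `α_k = ∑_{i < j} (p_i · p_j)^k`. -/
noncomputable def alpha (n d k : ℕ) : PolyRing n d :=
  ∑ q : Fin n × Fin n with q.1 < q.2, dot q.1 q.2 ^ k

/-- The family of all `θ_k`, `1 ≤ k ≤ d`, and all `α_k`, `1 ≤ k ≤ d (d + 1) / 2`, for
`n = d + 1` momenta. -/
noncomputable def primaries (d : ℕ) : Fin d ⊕ Fin (d * (d + 1) / 2) → PolyRing (d + 1) d :=
  Sum.elim (fun k => theta (d + 1) d (k + 1)) (fun k => alpha (d + 1) d (k + 1))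

end LorentzPerm

/-! Everything rests on one integrality statement, `isIntegral_adjoin_primaries`, proved with
valuations. Let `p` be the generic point over an algebraically closed field `K` containing `ℂ[V]`,
and let `V ⊆ K` be a valuation ring containing the θ's and α's. The Gram matrix of `p` is singular,
being of size `d + 1` and rank at most `d`. If some entry were outside `V`, rescaling and reducing
modulo the maximal ideal would give a nonzero singular symmetric matrix over the residue field with
all listed power sums zero, which Newton's identities exclude (`matrix_mem_of_psum_mem`). So all dot
products lie in `V`, and Gram–Schmidt over `V` gives an orthogonal `g` such that `g p` has
coordinates in `V`. An invariant `f` thus satisfies `f(p) = f(g p) ∈ V`; as `V` is arbitrary, `f` is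
integral.

The nullcone condition follows since integrality forces homogeneous invariants of positive degree to
vanish where the primaries do. For the rest, restrict to the slice of triangular families, of
dimension `d(d+3)/2`. Its coordinates are algebraic over the restricted primaries, so these are
independent by transcendence degree. Restriction is injective on invariants and embeds them into the
integral closure of a polynomial ring in the slice ring, which is a finite module. -/

namespace LorentzPerm

/-! ### Newton's identities and singular symmetric matrices -/

section PowerSums

variable {k ι : Type*} [Field k] [Fintype ι]

/-- Each `x i` is a root of `∏ (X - x j)`, which reduces to a pure power of `X`. -/
theorem eq_zero_of_esymm_eq_zero {x : ι → k}
    (h : ∀ j, 1 ≤ j → j ≤ Fintype.card ι → MvPolynomial.aeval x (MvPolynomial.esymm ι k j) = 0)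
    (i : ι) : x i = 0 := by
  have key := congrArg (Polynomial.eval (x i))
    (Multiset.prod_X_sub_X_eq_sum_esymm (Finset.univ.val.map x))
  have hl : Polynomial.eval (x i)
      ((Multiset.map (fun t => Polynomial.X - Polynomial.C t) (Finset.univ.val.map x)).prod) = 0 := by
    rw [Multiset.map_map]
    change Polynomial.eval (x i) (∏ j : ι, (Polynomial.X - Polynomial.C (x j))) = 0
    rw [Polynomial.eval_prod]
    exact Finset.prod_eq_zero (Finset.mem_univ i) (by simp)
  rw [hl, Polynomial.eval_finsetSum, Finset.sum_range_succ', Finset.sum_eq_zero] at key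
  · have h0 : (Finset.univ.val.map x).esymm 0 = 1 := by simp [Multiset.esymm]
    simp only [h0, zero_add, pow_zero, map_one, one_mul, Nat.sub_zero, Polynomial.eval_pow,
      Polynomial.eval_X] at key
    exact eq_zero_of_pow_eq_zero key.symm
  · intro j hj
    have hj' : j + 1 ≤ Fintype.card ι := by simpa using Finset.mem_range.1 hj
    have := h (j + 1) (by omega) hj'
    rw [MvPolynomial.aeval_esymm_eq_multiset_esymm] at this
    simp [this]

variable [CharZero k]

/-- By Newton's identities, a vanishing initial segment of power sums forces the corresponding
elementary symmetric polynomials to vanish. -/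
theorem aeval_esymm_eq_zero_of_psum {x : ι → k} {m : ℕ}
    (h : ∀ j, 1 ≤ j → j ≤ m → ∑ i, x i ^ j = 0) {j : ℕ} (hj : 1 ≤ j) (hjm : j ≤ m) :
    MvPolynomial.aeval x (MvPolynomial.esymm ι k j) = 0 := by
  have key := congrArg (MvPolynomial.aeval x) (MvPolynomial.mul_esymm_eq_sum ι k j)
  have hzero : MvPolynomial.aeval x (∑ a ∈ Finset.HasAntidiagonal.antidiagonal j with a.1 < j,
      (-1) ^ a.1 * MvPolynomial.esymm ι k a.1 * MvPolynomial.psum ι k a.2) = 0 := by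
    rw [map_sum]
    refine Finset.sum_eq_zero fun a ha => ?_
    rw [Finset.mem_filter, Finset.HasAntidiagonal.mem_antidiagonal] at ha
    have : MvPolynomial.aeval x (MvPolynomial.psum ι k a.2) = 0 := by
      simpa [MvPolynomial.psum] using h a.2 (by omega) (by omega)
    rw [map_mul, this, mul_zero]
  rw [map_mul, map_mul, hzero, mul_zero, map_natCast] at key
  exact (mul_eq_zero.1 key).resolve_left (by exact_mod_cast (by omega : j ≠ 0))

theorem eq_zero_of_psum_eq_zero {x : ι → k}
    (h : ∀ j, 1 ≤ j → j ≤ Fintype.card ι → ∑ i, x i ^ j = 0) (i : ι) : x i = 0 :=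
  eq_zero_of_esymm_eq_zero (fun _ hj hjm => aeval_esymm_eq_zero_of_psum h hj hjm) i

/-- The product is the top elementary symmetric polynomial, so it replaces the last power sum. This
is why `d` of the θ's suffice for `d + 1` diagonal entries. -/
theorem eq_zero_of_psum_eq_zero_of_prod_eq_zero {x : ι → k}
    (h : ∀ j, 1 ≤ j → j < Fintype.card ι → ∑ i, x i ^ j = 0) (hprod : ∏ i, x i = 0) (i : ι) :
    x i = 0 := by
  refine eq_zero_of_esymm_eq_zero (fun j hj hjm => ?_) i
  rcases hjm.lt_or_eq with hlt | rfl
  · exact aeval_esymm_eq_zero_of_psum (m := Fintype.card ι - 1)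
      (fun l hl hlm => h l hl (by omega)) hj (by omega)
  · rw [MvPolynomial.esymm, ← Finset.card_univ, Finset.powersetCard_self]
    simpa using hprod

theorem card_lt_pairs (d : ℕ) :
    Fintype.card {q : Fin (d + 1) × Fin (d + 1) // q.1 < q.2} = d * (d + 1) / 2 := by
  rw [Fintype.card_congr (Equiv.subtypeProdEquivSigmaSubtype
    (fun i j : Fin (d + 1) => i < j)), Fintype.card_sigma]
  have h1 : ∀ i : Fin (d + 1), Fintype.card {j : Fin (d + 1) // i < j} = d - i := by
    intro i
    rw [Fintype.card_subtype, ← Fin.card_Ioi i |>.trans (by omega : d + 1 - 1 - (i : ℕ) = d - i)]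
    congr 1
    ext j
    simp
  rw [Finset.sum_congr rfl fun i _ => h1 i, Fin.sum_univ_eq_sum_range (fun i => d - i) (d + 1)]
  have := Finset.sum_range_reflect (fun i => i) (d + 1)
  simp only [Nat.add_sub_cancel] at this
  rw [this, Finset.sum_range_id, Nat.add_sub_cancel, mul_comm]

/-- The α's kill the off-diagonal entries; the determinant is then the product of the diagonal ones,
the missing condition on the diagonal. -/
theorem matrix_eq_zero_of_psum_eq_zero {d : ℕ} {s : Matrix (Fin (d + 1)) (Fin (d + 1)) k}
    (hsymm : ∀ i j, s i j = s j i) (hdet : s.det = 0)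
    (hθ : ∀ l, 1 ≤ l → l ≤ d → ∑ i, s i i ^ l = 0)
    (hα : ∀ l, 1 ≤ l → l ≤ d * (d + 1) / 2 →
      ∑ q : Fin (d + 1) × Fin (d + 1) with q.1 < q.2, s q.1 q.2 ^ l = 0) : s = 0 := by
  have hlt : ∀ i j, i < j → s i j = 0 := by
    intro i j hij
    refine eq_zero_of_psum_eq_zero (ι := {q : Fin (d + 1) × Fin (d + 1) // q.1 < q.2})
      (x := fun q => s q.1.1 q.1.2) (fun l hl hlc => ?_) ⟨(i, j), hij⟩
    rw [card_lt_pairs] at hlc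
    rw [← hα l hl hlc]
    exact (Finset.sum_subtype _ (by simp) fun q : Fin (d + 1) × Fin (d + 1) => s q.1 q.2 ^ l).symm
  have hne : ∀ i j, i ≠ j → s i j = 0 := fun i j hij =>
    (lt_or_gt_of_ne hij).elim (hlt i j) fun h => (hsymm i j).trans (hlt j i h)
  have hdiag : Matrix.diagonal (fun i => s i i) = s := by
    ext i j
    by_cases hij : i = j
    · subst hij; simp
    · rw [Matrix.diagonal_apply_ne _ hij, hne i j hij]
  have hd : ∀ i, s i i = 0 := by
    refine eq_zero_of_psum_eq_zero_of_prod_eq_zero (x := fun i => s i i) (fun l hl hlc => ?_) ?_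
    · exact hθ l hl (by simpa using Nat.lt_succ_iff.1 (by simpa using hlc))
    · rw [← Matrix.det_diagonal, hdiag, hdet]
  rw [← hdiag]
  ext i j
  simp [Matrix.diagonal_apply, hd]

end PowerSums

/-! ### Valuation rings and integrality -/

section Valuation

variable {K : Type*} [Field K]

/-- A finite family that is not contained in a valuation ring can be rescaled by a nonunit into the
valuation ring, with `1` among the rescaled values. -/
theorem exists_rescaling (V : ValuationSubring K) {ι : Type*} [Finite ι] {x : ι → K}
    (hx : ¬ ∀ i, x i ∈ V) :
    ∃ t : V, t ∈ IsLocalRing.maximalIdeal V ∧ (∀ i, (t : K) * x i ∈ V) ∧ ∃ i, (t : K) * x i = 1 := by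
  push Not at hx
  obtain ⟨j, hj⟩ := hx
  have : Nonempty ι := ⟨j⟩
  obtain ⟨i, hi⟩ := Finite.exists_max fun i => V.valuation (x i)
  have h1 : 1 < V.valuation (x i) :=
    lt_of_lt_of_le (not_le.1 fun h => hj ((V.valuation_le_one_iff _).1 h)) (hi j)
  have h0 : V.valuation (x i) ≠ 0 := (zero_lt_one.trans h1).ne'
  have hx0 : x i ≠ 0 := (Valuation.ne_zero_iff _).1 h0
  have ht : V.valuation (x i)⁻¹ < 1 := by
    rw [map_inv₀]; exact inv_lt_one_of_one_lt₀ h1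
  refine ⟨⟨(x i)⁻¹, (V.valuation_le_one_iff _).1 ht.le⟩, ?_, fun l => ?_, i, inv_mul_cancel₀ hx0⟩
  · exact (V.valuation_lt_one_iff _).2 ht
  · rw [← V.valuation_le_one_iff, map_mul, map_inv₀]
    exact inv_mul_le_one_of_le₀ (hi l) zero_le

theorem matrix_mem_of_psum_mem [Algebra ℂ K] (V : ValuationSubring K)
    (hV : ∀ c : ℂ, algebraMap ℂ K c ∈ V) {d : ℕ} {s : Matrix (Fin (d + 1)) (Fin (d + 1)) K}
    (hsymm : ∀ i j, s i j = s j i) (hdet : s.det = 0)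
    (hθ : ∀ l, 1 ≤ l → l ≤ d → ∑ i, s i i ^ l ∈ V)
    (hα : ∀ l, 1 ≤ l → l ≤ d * (d + 1) / 2 →
      ∑ q : Fin (d + 1) × Fin (d + 1) with q.1 < q.2, s q.1 q.2 ^ l ∈ V) (i j) : s i j ∈ V := by
  by_contra hij
  obtain ⟨t, ht, htV, ⟨⟨a, b⟩, hab⟩⟩ := exists_rescaling V
    (x := fun q : Fin (d + 1) × Fin (d + 1) => s q.1 q.2) fun h => hij (h (i, j))
  let c : ℂ →+* V := (algebraMap ℂ K).codRestrict V.toSubring hV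
  let res := IsLocalRing.residue V
  have : CharZero (IsLocalRing.ResidueField V) :=
    charZero_of_injective_ringHom (res.comp c).injective
  let r : Matrix (Fin (d + 1)) (Fin (d + 1)) V := Matrix.of fun i j => ⟨t * s i j, htV (i, j)⟩
  have hr : r.map V.subtype = (t : K) • s := by ext; rfl
  have hrt : res t = 0 := (IsLocalRing.residue_eq_zero_iff t).2 ht
  have hdetr : r.det = 0 := by
    apply V.subtype_injective
    rw [map_zero, RingHom.map_det, RingHom.mapMatrix_apply, hr, Matrix.det_smul, hdet, mul_zero]
  -- Rescaling multiplies the `l`-th power sum by `t ^ l`, so its residue is zero as `l` is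
  -- positive.
  have hpow : ∀ l, 1 ≤ l → ∀ y : K, ∀ hy : y ∈ V, ∀ z : V, (z : K) = t ^ l * y → res z = 0 := by
    intro l hl y hy z hz
    have : z = t ^ l * ⟨y, hy⟩ := Subtype.ext hz
    rw [this, map_mul, map_pow, hrt, zero_pow (by omega), zero_mul]
  have h0 := matrix_eq_zero_of_psum_eq_zero (s := res.mapMatrix r) (d := d)
    (fun i j => by simp [r, hsymm i j])
    (by rw [← RingHom.map_det, hdetr, map_zero])
    (fun l hl hld => by
      have := hpow l hl _ (hθ l hl hld) (∑ i, r i i ^ l)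
        (by simp [r, mul_pow, Finset.mul_sum])
      simpa using this)
    (fun l hl hld => by
      have := hpow l hl _ (hα l hl hld)
        (∑ q : Fin (d + 1) × Fin (d + 1) with q.1 < q.2, r q.1 q.2 ^ l)
        (by simp [r, mul_pow, Finset.mul_sum])
      simpa using this)
  have h1 : res (r a b) = 0 := congrFun (congrFun h0 a) b
  have h2 : r a b = 1 := Subtype.ext hab
  rw [h2, map_one] at h1
  exact one_ne_zero h1

/-- An element of a field that lies in all valuation rings over the image of a ring is integral
over that ring. -/
theorem isIntegral_of_forall_valuationSubring {A : Type*} [CommRing A] [Algebra A K] {x : K}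
    (h : ∀ V : ValuationSubring K, (∀ a : A, algebraMap A K a ∈ V) → x ∈ V) : IsIntegral A x := by
  let B : Subalgebra A K := ⊥
  have hx : x ∈ (integralClosure (Subring.closure (B.toSubring : Set K)) K).toSubring := by
    rw [← iInf_valuationSubring_superset, Subring.mem_iInf]
    exact fun V => h V.1 fun a => V.2 (B.algebraMap_mem a)
  rw [Subring.closure_eq] at hx
  have hx' : IsIntegral B x := hx
  have : Algebra.IsIntegral A B := Algebra.IsIntegral.of_surjective (Algebra.ofId A B) (by
    rintro ⟨y, hy⟩
    obtain ⟨a, rfl⟩ := Algebra.mem_bot.1 hy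
    exact ⟨a, rfl⟩)
  exact isIntegral_trans x hx'

end Valuation

/-! ### Gram–Schmidt over a valuation ring -/

section Orthonormal

variable {K : Type*} [Field K]

/-- Pivoted Gram–Schmidt over a valuation ring: a spanning family whose dot products lie in the
valuation ring has coordinates in the valuation ring with respect to some orthonormal basis. -/
theorem exists_orthonormal_dotProduct_mem [IsAlgClosed K] (V : ValuationSubring K)
    (h2 : (2 : K) ≠ 0) (h2V : (2 : K)⁻¹ ∈ V) {ι : Type*} [Finite ι] {d : ℕ} (p : ι → Fin d → K)
    (hspan : ∀ w : Fin d → K, (∀ i, p i ⬝ᵥ w = 0) → w = 0) (hp : ∀ i j, p i ⬝ᵥ p j ∈ V) :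
    ∀ m ≤ d, ∃ e : Fin m → Fin d → K,
      (∀ a b, e a ⬝ᵥ e b = if a = b then 1 else 0) ∧ ∀ i a, p i ⬝ᵥ e a ∈ V := by
  intro m
  induction m with
  | zero => exact fun _ => ⟨Fin.elim0, fun a => a.elim0, fun _ a => a.elim0⟩
  | succ m ih =>
    intro hm
    obtain ⟨e, he, hpe⟩ := ih (by omega)
    let q : ι → Fin d → K := fun i => p i - ∑ a, (p i ⬝ᵥ e a) • e a
    have hqe : ∀ i a, q i ⬝ᵥ e a = 0 := fun i a => by
      simp [q, sub_dotProduct, sum_dotProduct, smul_dotProduct, he]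
    have hqp : ∀ i j, q i ⬝ᵥ p j = q i ⬝ᵥ q j := fun i j => by
      have : p j = q j + ∑ a, (p j ⬝ᵥ e a) • e a := by simp [q]
      conv_lhs => rw [this]
      simp [dotProduct_add, dotProduct_sum, dotProduct_smul, hqe]
    have hqV : ∀ i j, q i ⬝ᵥ q j ∈ V := fun i j => by
      rw [← hqp]
      simp only [q, sub_dotProduct, sum_dotProduct, smul_dotProduct, smul_eq_mul]
      refine V.toSubring.sub_mem (hp i j) (V.toSubring.sum_mem fun a _ => V.mul_mem _ _ (hpe i a) ?_)
      rw [dotProduct_comm]; exact hpe j a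
    have hι : Nonempty ι := by
      by_contra h
      have := hspan (fun _ => 1) fun i => (h ⟨i⟩).elim
      exact one_ne_zero (congrFun this ⟨0, by omega⟩)
    -- All `q i` may be isotropic, so the pivot is sought among the sums `q i + q j`: by
    -- polarization, with `2` a unit, the largest square dominates every `q i ⬝ᵥ q j`.
    let u : ι × ι → Fin d → K := fun x => q x.1 + q x.2
    obtain ⟨x, hx⟩ := Finite.exists_max fun x => V.valuation (u x ⬝ᵥ u x)
    have h2V' : (2 : K) ∈ V := by
      have := V.add_mem _ _ V.one_mem V.one_mem
      rwa [one_add_one_eq_two] at this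
    have hv2 : V.valuation 2 = 1 := by
      refine le_antisymm ((V.valuation_le_one_iff _).2 h2V') ?_
      have := (V.valuation_le_one_iff _).2 h2V
      rwa [map_inv₀, inv_le_one₀ (zero_lt_iff.2 ((Valuation.ne_zero_iff _).2 h2))] at this
    have hqq : ∀ i, V.valuation (q i ⬝ᵥ q i) ≤ V.valuation (u x ⬝ᵥ u x) := fun i => by
      refine le_trans (le_of_eq ?_) (hx (i, i))
      have : u (i, i) ⬝ᵥ u (i, i) = 2 * 2 * (q i ⬝ᵥ q i) := by
        simp only [u, add_dotProduct, dotProduct_add]; ring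
      rw [this, map_mul, map_mul, hv2, one_mul, one_mul]
    have hle : ∀ i j, V.valuation (q i ⬝ᵥ q j) ≤ V.valuation (u x ⬝ᵥ u x) := fun i j => by
      have : V.valuation (q i ⬝ᵥ q j) = V.valuation
          (u (i, j) ⬝ᵥ u (i, j) - q i ⬝ᵥ q i - q j ⬝ᵥ q j) := by
        rw [← one_mul (V.valuation _), ← hv2, ← map_mul]
        congr 1
        simp only [u, add_dotProduct, dotProduct_add, dotProduct_comm (q j) (q i)]; ring
      rw [this]
      exact V.valuation.map_sub_le (V.valuation.map_sub_le (hx (i, j)) (hqq i)) (hqq j)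
    have hux : u x ⬝ᵥ u x ≠ 0 := by
      intro h0
      have hq0 : ∀ i, q i = 0 := fun i => hspan _ fun j => by
        have := hle i j
        rw [h0, map_zero, le_zero_iff, Valuation.zero_iff] at this
        rw [dotProduct_comm, hqp, this]
      -- If every `q i` vanished, all `p i` would lie in the span of `m < d` vectors, against
      -- `hspan`.
      have hker := LinearMap.ker_ne_bot_of_finrank_lt (f := Matrix.mulVecLin (Matrix.of e))
        (by simp; omega)
      obtain ⟨w, hw, hw0⟩ := (Submodule.ne_bot_iff _).1 hker
      refine hw0 (hspan w fun i => ?_)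
      have hpi : p i = ∑ a, (p i ⬝ᵥ e a) • e a := sub_eq_zero.1 (hq0 i)
      rw [hpi, sum_dotProduct]
      refine Finset.sum_eq_zero fun a _ => ?_
      have : e a ⬝ᵥ w = 0 := congrFun (LinearMap.mem_ker.1 hw) a
      rw [smul_dotProduct, this, smul_zero]
    obtain ⟨c, hc⟩ := IsAlgClosed.exists_pow_nat_eq (u x ⬝ᵥ u x) zero_lt_two
    have hc0 : c ≠ 0 := fun h => hux (by rw [← hc, h]; simp)
    have hue : ∀ a, u x ⬝ᵥ e a = 0 := fun a => by simp [u, add_dotProduct, hqe]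
    refine ⟨Fin.cons (c⁻¹ • u x) e, fun a b => ?_, fun i a => ?_⟩
    · refine Fin.cases ?_ (fun a => ?_) a <;> refine Fin.cases ?_ (fun b => ?_) b
      · simp [smul_dotProduct, dotProduct_smul, ← hc]
        field_simp
      · simp [smul_dotProduct, hue, (Fin.succ_ne_zero b).symm]
      · simp [dotProduct_comm (e a), hue]
      · simp [he]
    · refine Fin.cases ?_ (fun a => ?_) a
      · have hpu : p i ⬝ᵥ u x = q x.1 ⬝ᵥ q i + q x.2 ⬝ᵥ q i := by
          rw [dotProduct_comm]; simp [u, add_dotProduct, hqp]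
        have hvc : V.valuation c ≤ 1 := by
          have : V.valuation (c ^ 2) ≤ 1 := by
            rw [hc]
            refine (V.valuation_le_one_iff _).2 ?_
            simp only [u, add_dotProduct, dotProduct_add]
            exact V.add_mem _ _ (V.add_mem _ _ (hqV _ _) (hqV _ _))
              (V.add_mem _ _ (hqV _ _) (hqV _ _))
          rw [map_pow] at this
          exact (pow_le_one_iff two_ne_zero).1 this
        -- By maximality of the pivot this product is divisible by `c ^ 2`, so dividing by `c ∈ V`
        -- stays in `V`.
        have hle' : V.valuation (p i ⬝ᵥ u x) ≤ V.valuation c * V.valuation c := by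
          rw [← map_mul, ← sq, hc, hpu]
          exact Valuation.map_add_le _ (hle _ _) (hle _ _)
        rw [Fin.cons_zero, dotProduct_smul, smul_eq_mul, ← V.valuation_le_one_iff, map_mul, map_inv₀]
        refine inv_mul_le_one_of_le₀ (hle'.trans ?_) zero_le
        exact mul_le_of_le_one_left' hvc
      · exact hpe i a

theorem exists_orthogonal_mulVec_mem [IsAlgClosed K] (V : ValuationSubring K)
    (h2 : (2 : K) ≠ 0) (h2V : (2 : K)⁻¹ ∈ V) {ι : Type*} [Finite ι] {d : ℕ} (p : ι → Fin d → K)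
    (hspan : ∀ w : Fin d → K, (∀ i, p i ⬝ᵥ w = 0) → w = 0) (hp : ∀ i j, p i ⬝ᵥ p j ∈ V) :
    ∃ g : Matrix (Fin d) (Fin d) K, g * g.transpose = 1 ∧ ∀ i a, g.mulVec (p i) a ∈ V := by
  obtain ⟨e, he, hpe⟩ := exists_orthonormal_dotProduct_mem V h2 h2V p hspan hp d le_rfl
  refine ⟨Matrix.of e, ?_, fun i a => ?_⟩
  · ext a b
    rw [Matrix.one_apply, ← he a b]
    rfl
  · have := hpe i a
    rwa [dotProduct_comm] at this

end Orthonormal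

/-! ### Orthogonal invariance over extension fields -/

section Invariance

variable {n d : ℕ}

theorem eval_pullback (A : Matrix (Fin d) (Fin d) ℂ) (σ : Equiv.Perm (Fin n)) (f : PolyRing n d)
    (v : Fin n × Fin d → ℂ) :
    MvPolynomial.eval v (pullback A σ f) =
      MvPolynomial.eval (fun x => ∑ b, A x.2 b * v (σ⁻¹ x.1, b)) f := by
  rw [pullback, ← MvPolynomial.coe_aeval_eq_eval, ← MvPolynomial.coe_aeval_eq_eval, RingHom.coe_coe,
    RingHom.coe_coe, ← AlgHom.comp_apply, MvPolynomial.comp_aeval]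
  simp

/-- The polynomial `f (A p) - f p` in the entries of a matrix `A` and the coordinates of `p`. -/
noncomputable def orbitDifference (f : PolyRing n d) :
    MvPolynomial ((Fin d × Fin d) ⊕ (Fin n × Fin d)) ℂ :=
  MvPolynomial.aeval (fun x : Fin n × Fin d =>
      ∑ b, MvPolynomial.X (Sum.inl (x.2, b)) * MvPolynomial.X (Sum.inr (x.1, b))) f -
    MvPolynomial.aeval (fun x => MvPolynomial.X (Sum.inr x)) f

theorem aeval_orbitDifference {K : Type*} [Field K] [Algebra ℂ K] (f : PolyRing n d)
    (z : (Fin d × Fin d) ⊕ (Fin n × Fin d) → K) :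
    MvPolynomial.aeval z (orbitDifference f) = MvPolynomial.aeval (fun x : Fin n × Fin d =>
      ∑ b, z (Sum.inl (x.2, b)) * z (Sum.inr (x.1, b))) f -
        MvPolynomial.aeval (fun x => z (Sum.inr x)) f := by
  simp only [orbitDifference, map_sub, ← AlgHom.comp_apply, MvPolynomial.comp_aeval]
  simp

/-- By the Nullstellensatz, invariance under the complex orthogonal group implies invariance under
the orthogonal group over any extension field. -/
theorem aeval_orthogonal_eq {f : PolyRing n d}
    (hf : ∀ A ∈ Matrix.orthogonalGroup (Fin d) ℂ, pullback A 1 f = f)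
    {K : Type*} [Field K] [Algebra ℂ K] {g : Matrix (Fin d) (Fin d) K} (hg : g * g.transpose = 1)
    (p : Fin n × Fin d → K) :
    MvPolynomial.aeval (fun x : Fin n × Fin d => ∑ b, g x.2 b * p (x.1, b)) f =
      MvPolynomial.aeval p f := by
  let r : Fin d × Fin d → MvPolynomial ((Fin d × Fin d) ⊕ (Fin n × Fin d)) ℂ := fun q =>
    ∑ c, MvPolynomial.X (Sum.inl (q.1, c)) * MvPolynomial.X (Sum.inl (q.2, c)) -
      MvPolynomial.C (if q.1 = q.2 then 1 else 0)
  -- Membership in the radical is enough: over the field `K` a vanishing power vanishes.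
  have hmem : orbitDifference f ∈ (Ideal.span (Set.range r)).radical := by
    rw [← MvPolynomial.vanishingIdeal_zeroLocus_eq_radical (K := ℂ),
      MvPolynomial.mem_vanishingIdeal_iff]
    intro z hz
    rw [MvPolynomial.zeroLocus_span] at hz
    let A : Matrix (Fin d) (Fin d) ℂ := Matrix.of fun a b => z (Sum.inl (a, b))
    have hA : A ∈ Matrix.orthogonalGroup (Fin d) ℂ := by
      rw [Matrix.mem_orthogonalGroup_iff]
      ext a b
      have := hz (r (a, b)) ⟨_, rfl⟩
      simp only [r, map_sub, map_sum, map_mul, MvPolynomial.aeval_X, MvPolynomial.aeval_C,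
        sub_eq_zero] at this
      rw [Matrix.mul_apply, Matrix.one_apply]
      exact this
    have := congrArg (MvPolynomial.eval fun x => z (Sum.inr x)) (hf A hA)
    rw [eval_pullback] at this
    rw [aeval_orbitDifference, sub_eq_zero]
    exact this
  obtain ⟨N, hN⟩ := hmem
  let z : (Fin d × Fin d) ⊕ (Fin n × Fin d) → K := Sum.elim (fun q => g q.1 q.2) p
  have hker : Ideal.span (Set.range r) ≤ RingHom.ker (MvPolynomial.aeval (R := ℂ) z) := by
    rw [Ideal.span_le]
    rintro _ ⟨⟨a, b⟩, rfl⟩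
    have := congrFun (congrFun hg a) b
    rw [Matrix.mul_apply, Matrix.one_apply] at this
    simp only [SetLike.mem_coe, RingHom.mem_ker, r, z, map_sub, map_sum, map_mul,
      MvPolynomial.aeval_X, MvPolynomial.aeval_C, Sum.elim_inl, sub_eq_zero]
    rw [apply_ite (algebraMap ℂ K), map_one, map_zero]
    exact this
  have h0 := RingHom.mem_ker.1 (hker hN)
  rw [map_pow] at h0
  have := eq_zero_of_pow_eq_zero h0
  rwa [aeval_orbitDifference, sub_eq_zero] at this

end Invariance

/-! ### Invariance, homogeneity and integrality -/

section Primaries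

variable {n d : ℕ}

theorem aeval_dot {K : Type*} [CommRing K] [Algebra ℂ K] (p : Fin n × Fin d → K) (i j : Fin n) :
    MvPolynomial.aeval p (dot i j : PolyRing n d) = ∑ a, p (i, a) * p (j, a) := by
  simp [dot]

theorem dot_comm (i j : Fin n) : (dot i j : PolyRing n d) = dot j i := by
  simp [dot, mul_comm]

theorem pullback_dot {A : Matrix (Fin d) (Fin d) ℂ} (hA : A ∈ Matrix.orthogonalGroup (Fin d) ℂ)
    (σ : Equiv.Perm (Fin n)) (i j : Fin n) :
    pullback A σ (dot i j) = dot (σ⁻¹ i) (σ⁻¹ j) := by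
  rw [Matrix.mem_orthogonalGroup_iff'] at hA
  apply MvPolynomial.funext
  intro v
  rw [eval_pullback]
  have h : ∀ w : Fin n × Fin d → ℂ, ∀ i j : Fin n, MvPolynomial.eval w (dot i j : PolyRing n d) =
      (fun a => w (i, a)) ⬝ᵥ fun a => w (j, a) := fun w i j => by simp [dot, dotProduct]
  rw [h, h]
  change (A.mulVec fun a => v (σ⁻¹ i, a)) ⬝ᵥ (A.mulVec fun a => v (σ⁻¹ j, a)) = _
  rw [Matrix.dotProduct_mulVec, ← Matrix.mulVec_transpose, Matrix.mulVec_mulVec]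
  rw [hA, Matrix.one_mulVec]

/-- A permutation does not respect `q.1 < q.2`, but it does respect `q.1 ≠ q.2`, whose sum is twice
as large. -/
theorem sum_lt_perm {M : Type*} [CommRing M] [IsDomain M] [CharZero M] (F : Fin n → Fin n → M)
    (hF : ∀ i j, F i j = F j i) (σ : Equiv.Perm (Fin n)) :
    ∑ q : Fin n × Fin n with q.1 < q.2, F (σ q.1) (σ q.2) =
      ∑ q : Fin n × Fin n with q.1 < q.2, F q.1 q.2 := by
  have key : ∀ G : Fin n → Fin n → M, (∀ i j, G i j = G j i) →
      2 * ∑ q : Fin n × Fin n with q.1 < q.2, G q.1 q.2 =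
        ∑ q : Fin n × Fin n with q.1 ≠ q.2, G q.1 q.2 := by
    intro G hG
    have hswap : ∑ q : Fin n × Fin n with q.2 < q.1, G q.1 q.2 =
        ∑ q : Fin n × Fin n with q.1 < q.2, G q.1 q.2 :=
      Finset.sum_equiv (Equiv.prodComm _ _) (by simp) fun q _ => hG _ _
    rw [two_mul]
    nth_rw 2 [← hswap]
    rw [← Finset.sum_union (Finset.disjoint_filter.2 fun q _ h => h.not_gt), ← Finset.filter_or]
    simp only [ne_iff_lt_or_gt]
  apply mul_left_cancel₀ (two_ne_zero (α := M))
  rw [key _ hF, key (fun i j => F (σ i) (σ j)) fun i j => hF _ _]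
  exact Finset.sum_equiv (Equiv.prodCongr σ σ) (by simp) fun q _ => rfl

theorem pullback_theta {A : Matrix (Fin d) (Fin d) ℂ} (hA : A ∈ Matrix.orthogonalGroup (Fin d) ℂ)
    (σ : Equiv.Perm (Fin n)) (k : ℕ) : pullback A σ (theta n d k) = theta n d k := by
  simp only [theta, map_sum, map_pow, pullback_dot hA]
  exact Equiv.sum_comp σ⁻¹ fun i => (dot i i : PolyRing n d) ^ k

theorem pullback_alpha {A : Matrix (Fin d) (Fin d) ℂ} (hA : A ∈ Matrix.orthogonalGroup (Fin d) ℂ)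
    (σ : Equiv.Perm (Fin n)) (k : ℕ) : pullback A σ (alpha n d k) = alpha n d k := by
  simp only [alpha, map_sum, map_pow, pullback_dot hA]
  exact sum_lt_perm (fun i j => (dot i j : PolyRing n d) ^ k) (fun i j => by rw [dot_comm]) σ⁻¹

theorem primaries_mem (d : ℕ) (i) : primaries d i ∈ invariantAlgebra (d + 1) d ⊤ := by
  intro A hA σ _
  rcases i with k | k
  · exact pullback_theta hA σ _
  · exact pullback_alpha hA σ _

theorem isHomogeneous_dot_pow (i j : Fin n) (k : ℕ) :
    (dot i j ^ k : PolyRing n d).IsHomogeneous (2 * k) :=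
  MvPolynomial.IsHomogeneous.pow (MvPolynomial.IsHomogeneous.sum _ _ _ fun _ _ =>
    (MvPolynomial.isHomogeneous_X ℂ _).mul (MvPolynomial.isHomogeneous_X ℂ _)) k

theorem primaries_isHomogeneous (d : ℕ) (i) :
    ∃ k : ℕ, 0 < k ∧ (primaries d i).IsHomogeneous k := by
  rcases i with k | k
  · refine ⟨2 * (k + 1), by omega, ?_⟩
    exact MvPolynomial.IsHomogeneous.sum Finset.univ (fun i => dot i i ^ (k.1 + 1)) _ fun _ _ =>
      isHomogeneous_dot_pow _ _ _
  · refine ⟨2 * (k + 1), by omega, ?_⟩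
    exact MvPolynomial.IsHomogeneous.sum (Finset.univ.filter fun q => q.1 < q.2)
      (fun q : Fin (d + 1) × Fin (d + 1) => dot q.1 q.2 ^ (k.1 + 1)) _ fun _ _ =>
      isHomogeneous_dot_pow _ _ _

theorem det_gram_eq_zero {K : Type*} [Field K] (p : Fin (d + 1) → Fin d → K) :
    (Matrix.of fun i j => ∑ a, p i a * p j a).det = 0 := by
  by_contra h
  have h1 := Matrix.rank_of_isUnit (Matrix.of fun i j => ∑ a, p i a * p j a)
    ((Matrix.isUnit_iff_isUnit_det _).2 (isUnit_iff_ne_zero.2 h))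
  have h2 : (Matrix.of fun i j => ∑ a, p i a * p j a) = Matrix.of p * (Matrix.of p).transpose := by
    ext i j; simp [Matrix.mul_apply]
  rw [h2] at h1
  have h3 := (Matrix.rank_mul_le_left (Matrix.of p) (Matrix.of p).transpose).trans
    (Matrix.rank_le_card_width _)
  rw [h1] at h3
  simp at h3

theorem dot_mem_of_primaries_mem {K : Type*} [Field K] [Algebra ℂ K] (V : ValuationSubring K)
    (hV : ∀ c : ℂ, algebraMap ℂ K c ∈ V) (p : Fin (d + 1) × Fin d → K)
    (hp : ∀ i, MvPolynomial.aeval p (primaries d i) ∈ V) (i j : Fin (d + 1)) :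
    ∑ a, p (i, a) * p (j, a) ∈ V := by
  refine matrix_mem_of_psum_mem V hV (s := Matrix.of fun i j => ∑ a, p (i, a) * p (j, a))
    (fun i j => by simp [mul_comm]) (det_gram_eq_zero fun i a => p (i, a)) (fun l hl hld => ?_)
    (fun l hl hld => ?_) i j
  · have := hp (Sum.inl ⟨l - 1, by omega⟩)
    simpa [primaries, theta, aeval_dot, Nat.sub_add_cancel hl] using this
  · have := hp (Sum.inr ⟨l - 1, by omega⟩)
    simpa [primaries, alpha, aeval_dot, Nat.sub_add_cancel hl] using this

/-- The first `d` generic vectors form a basis: their determinant specializes to `1` at the identity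
matrix. -/
theorem eq_zero_of_forall_generic_dotProduct {K : Type*} [Field K] [Algebra (PolyRing (d + 1) d) K]
    (hinj : Function.Injective (algebraMap (PolyRing (d + 1) d) K)) {w : Fin d → K}
    (hw : ∀ i, (fun a => algebraMap (PolyRing (d + 1) d) K (MvPolynomial.X (i, a))) ⬝ᵥ w = 0) :
    w = 0 := by
  let N : Matrix (Fin d) (Fin d) (PolyRing (d + 1) d) :=
    Matrix.of fun i a => MvPolynomial.X (i.castSucc, a)
  have hN : N.det ≠ 0 := by
    intro h
    have := congrArg (MvPolynomial.eval fun x : Fin (d + 1) × Fin d =>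
      if x.1 = x.2.castSucc then (1 : ℂ) else 0) h
    have h1 : (MvPolynomial.eval fun x : Fin (d + 1) × Fin d =>
        if x.1 = x.2.castSucc then (1 : ℂ) else 0).mapMatrix N = 1 := by
      ext i a; simp [N, Matrix.one_apply]
    rw [RingHom.map_det, h1] at this
    simp at this
  have hdet : ((algebraMap (PolyRing (d + 1) d) K).mapMatrix N).det ≠ 0 := by
    rw [← RingHom.map_det]
    exact (map_ne_zero_iff _ hinj).2 hN
  exact Matrix.eq_zero_of_mulVec_eq_zero hdet (funext fun i => hw i.castSucc)

/-- Every `O(d)`-invariant polynomial in `d + 1` vectors is integral over the algebra generated by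
the power sums of the dot products. -/
theorem isIntegral_adjoin_primaries {f : PolyRing (d + 1) d}
    (hf : ∀ A ∈ Matrix.orthogonalGroup (Fin d) ℂ, pullback A 1 f = f) :
    IsIntegral (Algebra.adjoin ℂ (Set.range (primaries d))) f := by
  -- Algebraic closure supplies the square roots needed by Gram–Schmidt.
  let K := AlgebraicClosure (FractionRing (PolyRing (d + 1) d))
  have hinj : Function.Injective (algebraMap (PolyRing (d + 1) d) K) := by
    rw [IsScalarTower.algebraMap_eq _ (FractionRing (PolyRing (d + 1) d)) K]
    exact (algebraMap (FractionRing (PolyRing (d + 1) d)) K).injective.comp (IsFractionRing.injective _ _)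
  let B := Algebra.adjoin ℂ (Set.range (primaries d))
  have hK : CharZero K := charZero_of_injective_ringHom (algebraMap ℂ K).injective
  rw [← isIntegral_algebraMap_iff hinj]
  refine isIntegral_of_forall_valuationSubring fun V hV => ?_
  have hVB : ∀ b ∈ B, algebraMap (PolyRing (d + 1) d) K b ∈ V := fun b hb => hV ⟨b, hb⟩
  have hVC : ∀ c : ℂ, algebraMap ℂ K c ∈ V := fun c => by
    rw [IsScalarTower.algebraMap_apply ℂ (PolyRing (d + 1) d) K]
    exact hVB _ (B.algebraMap_mem c)
  let p : Fin (d + 1) × Fin d → K := fun x => algebraMap (PolyRing (d + 1) d) K (MvPolynomial.X x)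
  have hp : ∀ g : PolyRing (d + 1) d,
      MvPolynomial.aeval p g = algebraMap (PolyRing (d + 1) d) K g := fun g => by
    exact (MvPolynomial.aeval_algebraMap_apply K MvPolynomial.X g).trans (by
      rw [MvPolynomial.aeval_X_left_apply])
  have hdot := dot_mem_of_primaries_mem V hVC p fun i => by
    rw [hp]; exact hVB _ (Algebra.subset_adjoin ⟨i, rfl⟩)
  obtain ⟨g, hg, hgV⟩ := exists_orthogonal_mulVec_mem V two_ne_zero
    (by have := hVC 2⁻¹; rwa [map_inv₀, map_ofNat] at this) (fun i a => p (i, a))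
    (fun w hw => eq_zero_of_forall_generic_dotProduct hinj hw) hdot
  rw [← hp, ← aeval_orthogonal_eq hf hg]
  have hmem : ∀ (z : Fin (d + 1) × Fin d → K), (∀ x, z x ∈ V) → ∀ h : PolyRing (d + 1) d,
      MvPolynomial.aeval z h ∈ V := by
    intro z hz h
    rw [MvPolynomial.aeval_def, MvPolynomial.eval₂_eq]
    exact V.toSubring.sum_mem fun m _ => V.mul_mem _ _ (hVC _)
      (V.toSubring.prod_mem fun x _ => V.toSubring.pow_mem (hz x) _)
  exact hmem _ (fun x => hgV x.1 x.2) f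

/-! ### The nullcone condition -/

theorem eval_smul_of_isHomogeneous {K τ : Type*} [CommSemiring K] {f : MvPolynomial τ K} {k : ℕ}
    (hf : f.IsHomogeneous k) (t : K) (v : τ → K) :
    MvPolynomial.eval (t • v) f = t ^ k * MvPolynomial.eval v f := by
  rw [MvPolynomial.eval_eq, MvPolynomial.eval_eq, Finset.mul_sum]
  refine Finset.sum_congr rfl fun m hm => ?_
  have hdeg : ∑ i ∈ m.support, m i = k := by
    rw [← Finsupp.degree_apply]
    exact (DFunLike.congr_fun Finsupp.degree_eq_weight_one m).trans
      (hf (MvPolynomial.mem_support_iff.1 hm))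
  simp only [Pi.smul_apply, smul_eq_mul, mul_pow, Finset.prod_mul_distrib]
  rw [Finset.prod_pow_eq_pow_sum, hdeg]
  ring

/-- A homogeneous polynomial of positive degree that is integral over the algebra generated by
homogeneous polynomials of positive degree vanishes at their common zeros. -/
theorem eval_eq_zero_of_isIntegral_adjoin {K τ ι : Type*} [Field K] [Infinite K]
    {F : ι → MvPolynomial τ K} (hF : ∀ i, ∃ k : ℕ, 0 < k ∧ (F i).IsHomogeneous k)
    {f : MvPolynomial τ K} {k : ℕ} (hk : 0 < k) (hf : f.IsHomogeneous k)
    (hint : IsIntegral (Algebra.adjoin K (Set.range F)) f) {v : τ → K}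
    (hv : ∀ i, MvPolynomial.eval v (F i) = 0) : MvPolynomial.eval v f = 0 := by
  obtain ⟨P, hP, hPf⟩ := hint
  let B := Algebra.adjoin K (Set.range F)
  let ε : (τ → K) → B →+* K := fun w => (MvPolynomial.eval w).comp B.val.toRingHom
  -- The coefficients of the integral equation are constant along the line through `v`, whereas `f`
  -- scales by `t ^ k`; a nonzero `f v` would give a monic polynomial too many roots.
  have hε : ∀ t : K, ε (t • v) = ε v := by
    intro t
    ext ⟨b, hb⟩
    have hle : B ≤ AlgHom.equalizer (MvPolynomial.aeval (t • v)) (MvPolynomial.aeval v) := by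
      refine Algebra.adjoin_le ?_
      rintro _ ⟨i, rfl⟩
      obtain ⟨l, -, hl⟩ := hF i
      change MvPolynomial.eval (t • v) (F i) = MvPolynomial.eval v (F i)
      rw [eval_smul_of_isHomogeneous hl, hv, mul_zero]
    exact hle hb
  have hroot : ∀ t : K, (P.map (ε v)).eval (t ^ k * MvPolynomial.eval v f) = 0 := by
    intro t
    rw [← eval_smul_of_isHomogeneous hf, ← hε t, Polynomial.eval_map]
    have := congrArg (MvPolynomial.eval (t • v)) hPf
    rwa [Polynomial.hom_eval₂, map_zero] at this
  by_contra hc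
  have hcomp : (P.map (ε v)).comp
      (Polynomial.X ^ k * Polynomial.C (MvPolynomial.eval v f)) = 0 :=
    Polynomial.funext fun t => by
      rw [Polynomial.eval_comp, Polynomial.eval_mul, Polynomial.eval_pow, Polynomial.eval_X,
        Polynomial.eval_C, hroot, Polynomial.eval_zero]
  rcases Polynomial.comp_eq_zero_iff.1 hcomp with h | ⟨-, h⟩
  · exact (hP.map _).ne_zero h
  · have := congrArg (Polynomial.coeff · k) h
    simp [Polynomial.coeff_C, hk.ne'] at this
    exact hc this

theorem primaries_nullconeCondition (d : ℕ) :
    NullconeCondition (invariantAlgebra (d + 1) d ⊤) (primaries d) := by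
  ext v
  refine ⟨fun hv f hf k hk hfk => ?_, fun hv i => ?_⟩
  · exact eval_eq_zero_of_isIntegral_adjoin (primaries_isHomogeneous d) hk hfk
      (isIntegral_adjoin_primaries fun A hA => hf A hA 1 trivial) hv
  · obtain ⟨k, hk, hik⟩ := primaries_isHomogeneous d i
    exact hv _ (primaries_mem d i) k hk hik

end Primaries

/-! ### Finiteness of integral closures -/

section IntegralClosure

/-- The extension of fraction fields is finite, and separable in characteristic zero, so the
integral closure of `A` in `Frac S` is a Noetherian module; the one in `S` embeds into it. -/
theorem isNoetherian_integralClosure (A S : Type*) [CommRing A] [IsDomain A] [IsNoetherianRing A]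
    [IsIntegrallyClosed A] [CharZero A] [CommRing S] [IsDomain S] [Algebra A S] [FaithfulSMul A S]
    [Algebra.FiniteType A S] [Algebra.IsAlgebraic A S] : IsNoetherian A (integralClosure A S) := by
  let L := FractionRing S
  have : FaithfulSMul A L := (faithfulSMul_iff_algebraMap_injective A L).2 (by
    rw [IsScalarTower.algebraMap_eq A S L]
    exact (IsFractionRing.injective S L).comp (FaithfulSMul.algebraMap_injective A S))
  let := FractionRing.liftAlgebra A L
  let F := FractionRing A
  have : IsScalarTower A F L := inferInstance
  have : CharZero F := charZero_of_injective_algebraMap (IsFractionRing.injective A F)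
  have : Algebra.IsAlgebraic A L := by
    have : Algebra.IsAlgebraic S L := IsLocalization.isAlgebraic L (nonZeroDivisors S)
    exact .trans A S L
  have : Algebra.IsAlgebraic F L := .extendScalars (IsFractionRing.injective A F)
  have : Algebra.EssFiniteType S L := .of_isLocalization _ (nonZeroDivisors S)
  have : Algebra.EssFiniteType A L := .comp A S L
  have : Algebra.EssFiniteType F L := .of_comp A F L
  obtain ⟨s, hs⟩ := IntermediateField.fg_top F L
  have : FiniteDimensional F (⊤ : IntermediateField F L) := by
    rw [← hs]
    exact IntermediateField.finiteDimensional_adjoin fun x _ => (Algebra.IsAlgebraic.isAlgebraic x).isIntegral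
  have : FiniteDimensional F L := IntermediateField.topEquiv.toLinearEquiv.finiteDimensional
  have : IsNoetherian A (integralClosure A L) :=
    IsIntegralClosure.isNoetherian A F L (integralClosure A L)
  let φ : integralClosure A S →ₐ[A] integralClosure A L :=
    ((IsScalarTower.toAlgHom A S L).comp (integralClosure A S).val).codRestrict _
      fun x => x.2.map (IsScalarTower.toAlgHom A S L)
  refine isNoetherian_of_injective φ.toLinearMap fun x y hxy => ?_
  exact Subtype.ext (IsFractionRing.injective S L (congrArg Subtype.val hxy))

/-- A module of integral elements that embeds into a finitely generated algebraic domain over a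
Noetherian integrally closed domain of characteristic zero is finitely generated. -/
theorem submodule_fg_of_isIntegral {A S T : Type*} [CommRing A] [IsDomain A] [IsNoetherianRing A]
    [IsIntegrallyClosed A] [CharZero A] [CommRing S] [IsDomain S] [Algebra A S] [FaithfulSMul A S]
    [Algebra.FiniteType A S] [Algebra.IsAlgebraic A S] [CommRing T] [Algebra A T] (ψ : T →ₐ[A] S)
    (M : Submodule A T) (hint : ∀ f ∈ M, IsIntegral A f) (hinj : ∀ f ∈ M, ψ f = 0 → f = 0) :
    M.FG := by
  have := isNoetherian_integralClosure A S
  let φ : M →ₗ[A] integralClosure A S :=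
    { toFun := fun f => ⟨ψ f, (hint f f.2).map ψ⟩
      map_add' := fun f g => Subtype.ext (map_add ψ _ _)
      map_smul' := fun b f => Subtype.ext (map_smul ψ b (f : T)) }
  have : IsNoetherian A M := isNoetherian_of_injective φ
    ((injective_iff_map_eq_zero φ).2 fun f hf =>
      Subtype.ext (hinj f f.2 (congrArg Subtype.val hf)))
  exact Module.Finite.iff_fg.1 inferInstance

end IntegralClosure

/-! ### The triangular slice and algebraic independence -/

section Slice

variable {d : ℕ}

/-- The coordinates on the space of families `p` for which `p_i` has only its first `i + 1`
components nonzero. -/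
abbrev SliceIndex (d : ℕ) := {x : Fin (d + 1) × Fin d // (x.2 : ℕ) ≤ x.1}

/-- Restriction of polynomials to the families `p` for which `p_i` has only its first `i + 1`
components nonzero. -/
noncomputable def sliceMap (d : ℕ) : PolyRing (d + 1) d →ₐ[ℂ] MvPolynomial (SliceIndex d) ℂ :=
  MvPolynomial.aeval fun x => if h : (x.2 : ℕ) ≤ x.1 then MvPolynomial.X ⟨x, h⟩ else 0

theorem sliceMap_X_of_le {x : Fin (d + 1) × Fin d} (h : (x.2 : ℕ) ≤ x.1) :
    sliceMap d (MvPolynomial.X x) = MvPolynomial.X ⟨x, h⟩ := by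
  simp [sliceMap, h]

theorem sliceMap_X_of_lt {x : Fin (d + 1) × Fin d} (h : (x.1 : ℕ) < x.2) :
    sliceMap d (MvPolynomial.X x) = 0 := by
  simp [sliceMap, h.not_ge]

/-- Send `a` to the coordinate `(a, a)` and a pair `i < j` to `(j, i)`. -/
theorem card_le_card_sliceIndex (d : ℕ) :
    Fintype.card (Fin d ⊕ Fin (d * (d + 1) / 2)) ≤ Fintype.card (SliceIndex d) := by
  rw [Fintype.card_sum, Fintype.card_fin, Fintype.card_fin, ← card_lt_pairs]
  nth_rw 1 [← Fintype.card_fin d]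
  rw [← Fintype.card_sum]
  refine Fintype.card_le_of_injective (Sum.elim (fun a => ⟨(a.castSucc, a), le_rfl⟩)
    fun q => ⟨(q.1.2, ⟨q.1.1, by have := q.2; have := q.1.2.2; omega⟩), le_of_lt q.2⟩) ?_
  refine Function.Injective.sumElim ?_ ?_ ?_
  · intro a b h
    simpa using h
  · rintro ⟨⟨a, b⟩, h⟩ ⟨⟨a', b'⟩, h'⟩ hab
    simp only [Subtype.mk.injEq, Prod.mk.injEq, Fin.mk.injEq] at hab ⊢
    exact ⟨Fin.ext hab.2, hab.1⟩
  · rintro a ⟨⟨b, c⟩, h⟩ hab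
    simp only [Subtype.mk.injEq, Prod.mk.injEq, Fin.ext_iff] at hab
    simp only [Fin.lt_def] at h
    simp at hab
    omega

theorem pullback_dot_one {A : Matrix (Fin d) (Fin d) ℂ}
    (hA : A ∈ Matrix.orthogonalGroup (Fin d) ℂ) (i j : Fin (d + 1)) :
    pullback A 1 (dot i j) = dot i j := by
  simpa using pullback_dot hA 1 i j

theorem map_sliceMap_adjoin_primaries (d : ℕ) :
    (Algebra.adjoin ℂ (Set.range (primaries d))).map (sliceMap d) =
      Algebra.adjoin ℂ (Set.range (sliceMap d ∘ primaries d)) := by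
  rw [AlgHom.map_adjoin, ← Set.range_comp]

/-- Restriction to the slice on the algebra generated by the primary invariants. -/
noncomputable def sliceAdjoinHom (d : ℕ) : Algebra.adjoin ℂ (Set.range (primaries d)) →+*
    Algebra.adjoin ℂ (Set.range (sliceMap d ∘ primaries d)) :=
  ((sliceMap d).comp (Algebra.adjoin ℂ (Set.range (primaries d))).val).toRingHom.codRestrict
    (Algebra.adjoin ℂ (Set.range (sliceMap d ∘ primaries d))).toSubring fun b => by
      change sliceMap d b ∈ Algebra.adjoin ℂ (Set.range (sliceMap d ∘ primaries d))
      rw [← map_sliceMap_adjoin_primaries]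
      exact ⟨b, b.2, rfl⟩

theorem sliceAdjoinHom_surjective (d : ℕ) : Function.Surjective (sliceAdjoinHom d) := by
  rintro ⟨c, hc⟩
  rw [← map_sliceMap_adjoin_primaries] at hc
  obtain ⟨b, hb, rfl⟩ := hc
  exact ⟨⟨b, hb⟩, rfl⟩

/-- Dot products are integral over the primaries, and a triangular family is recovered from them
column by column, as in a Cholesky factorization: `p_a · p_a` gives the square of the diagonal
entry, then `p_a · p_i` gives the rest of column `a`. -/
theorem isAlgebraic_adjoin_sliceMap_primaries (d : ℕ) :
    Algebra.IsAlgebraic (Algebra.adjoin ℂ (Set.range (sliceMap d ∘ primaries d)))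
      (MvPolynomial (SliceIndex d) ℂ) := by
  let C := Algebra.adjoin ℂ (Set.range (sliceMap d ∘ primaries d))
  have hdot : ∀ i j, IsAlgebraic C (sliceMap d (dot i j)) := fun i j =>
    (IsIntegral.map_of_comp_eq (sliceAdjoinHom d) (sliceMap d).toRingHom rfl
      (isIntegral_adjoin_primaries fun A hA => pullback_dot_one hA i j)).isAlgebraic
  let q : Fin (d + 1) → Fin d → MvPolynomial (SliceIndex d) ℂ :=
    fun i a => sliceMap d (MvPolynomial.X (i, a))
  have hq : ∀ l : ℕ, ∀ a : Fin d, (a : ℕ) = l → ∀ i, IsAlgebraic C (q i a) := by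
    intro l
    induction l using Nat.strong_induction_on with
    | _ l ih =>
      intro a hal
      have hmul : ∀ i, IsAlgebraic C (q a.castSucc a * q i a) := by
        intro i
        have hsum : sliceMap d (dot a.castSucc i) =
            q a.castSucc a * q i a + ∑ b ∈ Finset.univ.erase a, q a.castSucc b * q i b := by
          rw [Finset.add_sum_erase _ (fun b => q a.castSucc b * q i b) (Finset.mem_univ a)]
          simp [dot, q]
        rw [eq_sub_of_add_eq hsum.symm]
        refine (hdot _ _).sub ((Subalgebra.algebraicClosure C _).sum_mem fun b hb => ?_)
        change IsAlgebraic C (q a.castSucc b * q i b)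
        rcases lt_or_gt_of_ne (Finset.ne_of_mem_erase hb) with h | h
        · exact (ih b (hal ▸ h) b rfl _).mul (ih b (hal ▸ h) b rfl _)
        · have : q a.castSucc b = 0 := sliceMap_X_of_lt h
          rw [this, zero_mul]
          exact isAlgebraic_zero
      have hdiag : IsAlgebraic C (q a.castSucc a) :=
        IsAlgebraic.of_pow zero_lt_two (by rw [sq]; exact hmul _)
      have hne : q a.castSucc a ≠ 0 := by
        simp only [q]
        rw [sliceMap_X_of_le le_rfl]
        exact MvPolynomial.X_ne_zero _
      exact fun i => hdiag.of_mul (mem_nonZeroDivisors_of_ne_zero hne) (hmul i)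
  refine ⟨fun f => ?_⟩
  induction f using MvPolynomial.induction_on with
  | C c => exact isAlgebraic_algebraMap (⟨_, C.algebraMap_mem c⟩ : C)
  | add f g hf hg => exact hf.add hg
  | mul_X f x hf =>
    refine hf.mul ?_
    rw [← sliceMap_X_of_le x.2]
    exact hq _ _ rfl _

/-- A family over which the ring is algebraic, with no more members than the transcendence degree,
is a transcendence basis. -/
theorem algebraicIndependent_sliceMap_primaries (d : ℕ) :
    AlgebraicIndependent ℂ (sliceMap d ∘ primaries d) := by
  have := isAlgebraic_adjoin_sliceMap_primaries d
  refine (Algebra.IsAlgebraic.isTranscendenceBasis_of_le_trdeg_of_finite ℂ _ ?_).1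
  rw [MvPolynomial.trdeg_of_isDomain, Cardinal.lift_id, Cardinal.mk_fintype, Cardinal.mk_fintype]
  exact_mod_cast card_le_card_sliceIndex d

theorem algebraicIndependent_primaries (d : ℕ) : AlgebraicIndependent ℂ (primaries d) :=
  (algebraicIndependent_sliceMap_primaries d).of_comp (sliceMap d)

theorem eval_sliceMap (f : PolyRing (d + 1) d) (v : Fin (d + 1) × Fin d → ℂ)
    (hv : ∀ x : Fin (d + 1) × Fin d, (x.1 : ℕ) < x.2 → v x = 0) :
    MvPolynomial.eval (fun x : SliceIndex d => v x.1) (sliceMap d f) = MvPolynomial.eval v f := by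
  rw [sliceMap, ← MvPolynomial.coe_aeval_eq_eval, ← MvPolynomial.coe_aeval_eq_eval, RingHom.coe_coe,
    RingHom.coe_coe, ← AlgHom.comp_apply, MvPolynomial.comp_aeval]
  congr 2
  funext x
  split_ifs with h
  · simp
  · simp [hv x (not_le.1 h)]

/-- By real Gram–Schmidt orthogonalization, an `O(d)`-invariant polynomial is determined by its
restriction to the slice. -/
theorem eq_zero_of_sliceMap_eq_zero {f : PolyRing (d + 1) d}
    (hf : ∀ A ∈ Matrix.orthogonalGroup (Fin d) ℂ, pullback A 1 f = f) (h0 : sliceMap d f = 0) :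
    f = 0 := by
  refine MvPolynomial.funext_set (fun _ => Set.range ((↑) : ℝ → ℂ))
    (fun _ => Set.infinite_range_of_injective Complex.ofReal_injective) fun v hv => ?_
  choose r hr using fun x => hv x (Set.mem_univ x)
  -- Vanishing at real points suffices, and there Gram–Schmidt meets no isotropic vectors. The last
  -- momentum is left out, since the slice does not constrain it.
  let w : Fin d → EuclideanSpace ℝ (Fin d) := fun i => WithLp.toLp 2 fun a => r (i.castSucc, a)
  let b := InnerProductSpace.gramSchmidtOrthonormalBasis (𝕜 := ℝ) (by simp) w
  let A : Matrix (Fin d) (Fin d) ℂ := Matrix.of fun a c => ((b a c : ℝ) : ℂ)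
  have hA : A ∈ Matrix.orthogonalGroup (Fin d) ℂ := by
    rw [Matrix.mem_orthogonalGroup_iff]
    ext a c
    have := orthonormal_iff_ite.1 b.orthonormal c a
    rw [PiLp.inner_apply] at this
    simp only [A, Matrix.mul_apply, Matrix.transpose_apply, Matrix.of_apply, Matrix.one_apply]
    have h := congrArg ((↑) : ℝ → ℂ) this
    simp only [RCLike.inner_apply, conj_trivial] at h
    push_cast at h
    rw [h]
    by_cases hac : a = c
    · simp [hac]
    · simp [hac, Ne.symm hac]
  rw [map_zero, ← hf A hA, eval_pullback, ← eval_sliceMap _ _ ?_, h0, map_zero]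
  rintro ⟨i, a⟩ (hia : (i : ℕ) < a)
  have htri := InnerProductSpace.gramSchmidtOrthonormalBasis_inv_triangular (𝕜 := ℝ) (by simp) w
    (i := ⟨i, by omega⟩) (j := a) hia
  rw [PiLp.inner_apply] at htri
  have h := congrArg ((↑) : ℝ → ℂ) htri
  simp only [RCLike.inner_apply, conj_trivial] at h
  push_cast at h
  rw [← h]
  refine Finset.sum_congr rfl fun c _ => ?_
  rw [mul_comm]
  congr 1
  exact (hr (i, c)).symm

end Slice

/-! ### Finite generation and conclusion -/

theorem adjoin_primaries_le (d : ℕ) :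
    Algebra.adjoin ℂ (Set.range (primaries d)) ≤ invariantAlgebra (d + 1) d ⊤ :=
  Algebra.adjoin_le (Set.range_subset_iff.2 (primaries_mem d))

/-- Independence makes the subalgebra of primaries a polynomial ring, hence Noetherian and
integrally closed. It acts on the slice ring by restriction, faithfully because the restricted
primaries are still independent. -/
theorem submodule_fg_of_le_invariantAlgebra (d : ℕ)
    (M : Submodule (Algebra.adjoin ℂ (Set.range (primaries d))) (PolyRing (d + 1) d))
    (hM : ∀ f ∈ M, f ∈ invariantAlgebra (d + 1) d ⊤) :
    M.FG := by
  let B := Algebra.adjoin ℂ (Set.range (primaries d))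
  let S := MvPolynomial (SliceIndex d) ℂ
  let e := (algebraicIndependent_primaries d).aevalEquiv
  have : IsNoetherianRing B := isNoetherianRing_of_ringEquiv _ e.toRingEquiv
  have : IsIntegrallyClosed B := .of_equiv e.toRingEquiv
  have : CharZero B := charZero_of_injective_algebraMap (algebraMap ℂ B).injective
  let : Algebra B S := ((sliceMap d).comp B.val).toRingHom.toAlgebra
  have : IsScalarTower ℂ B S := .of_algebraMap_eq fun c => ((sliceMap d).commutes c).symm
  have hmap : ∀ b : B, algebraMap B S b = sliceMap d b := fun _ => rfl
  have : FaithfulSMul B S := (faithfulSMul_iff_algebraMap_injective B S).2 (by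
    refine (injective_iff_map_eq_zero _).2 fun b hb => ?_
    obtain ⟨P, rfl⟩ := e.surjective b
    have hP : algebraMap B S (e P) = MvPolynomial.aeval (sliceMap d ∘ primaries d) P := by
      rw [hmap]
      exact DFunLike.congr_fun (MvPolynomial.comp_aeval (primaries d) (sliceMap d)) P
    rw [hP] at hb
    rw [(injective_iff_map_eq_zero _).1 (algebraicIndependent_sliceMap_primaries d) P hb, map_zero])
  have : Algebra.FiniteType B S := .of_restrictScalars_finiteType ℂ B S
  have : Algebra.IsAlgebraic B S := by
    refine ⟨fun x => ?_⟩
    have hx := (isAlgebraic_adjoin_sliceMap_primaries d).1 x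
    refine hx.of_ringHom_of_comp_eq (sliceAdjoinHom d) (RingHom.id S)
      (sliceAdjoinHom_surjective d) Function.injective_id rfl
  let ψ : PolyRing (d + 1) d →ₐ[B] S := { (sliceMap d).toRingHom with commutes' := fun _ => rfl }
  exact submodule_fg_of_isIntegral ψ M
    (fun f hf => isIntegral_adjoin_primaries fun A hA => hM f hf A hA 1 trivial)
    fun f hf => eq_zero_of_sliceMap_eq_zero fun A hA => hM f hf A hA 1 trivial

theorem primaries_isHSOP (d : ℕ) : IsHSOP (invariantAlgebra (d + 1) d ⊤) (primaries d) where
  mem := primaries_mem d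
  homogeneous := primaries_isHomogeneous d
  algebraicIndependent := algebraicIndependent_primaries d
  finite := by
    let R := invariantAlgebra (d + 1) d ⊤
    let M : Submodule (Algebra.adjoin ℂ (Set.range (primaries d))) (PolyRing (d + 1) d) :=
      { R.toSubring.toAddSubgroup.toAddSubmonoid with
        smul_mem' := fun b f hf => R.mul_mem (adjoin_primaries_le d b.2) hf }
    obtain ⟨t, ht⟩ := submodule_fg_of_le_invariantAlgebra d M fun f hf => hf
    exact ⟨t, fun g => by rw [ht]; rfl⟩

end LorentzPerm

theorem mainTheorem2 (d : ℕ) :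
    LorentzPerm.IsHSOP (LorentzPerm.invariantAlgebra (d + 1) d ⊤) (LorentzPerm.primaries d) ∧
    LorentzPerm.NullconeCondition (LorentzPerm.invariantAlgebra (d + 1) d ⊤)
      (LorentzPerm.primaries d) :=
  ⟨LorentzPerm.primaries_isHSOP d, LorentzPerm.primaries_nullconeCondition d⟩
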